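/- Let $d\ge 2$. For a frame $\chi=\{\psi_i\}_{i=1}^N$ of unit vectors in $\mathbb{C}^d$ put $$\mathcal{E}_k(\chi)=\frac1{N^2}\sum_{i,j=1}^N|\langle\psi_i|\psi_j\rangle|^{2k},\qquad \mathcal F_k(\chi)=\frac1N\sum_{i=1}^N(|\psi_i\rangle\langle\psi_i|)^{\otimes k},\qquad \rho_k=\frac{\Pi_k}{\mathrm{Tr}\,\Pi_k},$$ where $\Pi_k$ is the projector onto the symmetric subspace $\vee^k\mathbb{C}^d\subset(\mathbb{C}^d)^{\otimes k}$. The frame $\chi$ is a (complex projective) $k$-design if $\frac1N\sum_i p(\psi_i)=\mathbb{E}_{\phi\sim\mathrm{Haar}}[p(\phi)]$ for every polynomial $p$ that is bihomogeneous of degree $(k,k)$ in the amplitudes and their complex conjugates. The average error is $$\epsilon^{(k)}_{\mathrm{avg}}(\chi)=\Bigl(\mathbb{E}_{M}\Bigl[\|M\|_2^{-2}\,\bigl|\mathbb{E}_{\phi\sim\mathrm{Haar}}[p_M(\phi)]-\tfrac1N\textstyle\sum_i p_M(\psi_i)\bigr|^2\Bigr]\Bigr)^{1/2},\qquad p_M(\phi)=\langle\phi|^{\otimes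 k}M|\phi\rangle^{\otimes k},$$ where $M$ is a Ginibre random operator on $\vee^k\mathbb{C}^d$ (independent standard complex Gaussian matrix entries in an orthonormal basis) and $\|\cdot\|_2$ is the Hilbert–Schmidt norm. Then: 1. Every $1$-design $\chi$ in $\mathbb{C}^d$ with $|\chi|=d(d+1)$ satisfies $\mathcal{E}_3(\chi)\ge \frac1{d^2}$. 2. If there is a complete set of mutually unbiased bases of $\mathbb{C}^d$, that is, $d+1$ orthonormal bases such that $|\langle e|f\rangle|^2=\frac1d$ whenever $e,f$ belong to different bases, then the frame $\chi_{\mathrm{MUB}}$ of its $d(d+1)$ vectors is a $2$-design (hence a $1$-design), satisfies $\mathcal{E}_3(\chi_{\mathrm{MUB}})=\frac1{d^2}$, and is an optimal approximate $3$-design of its cardinality: among all $1$-designs of size $d(d+1)$ it minimizes $\mathcal{E}_3(\chi)$, $\|\mathcal F_3(\chi)-\rho_3\|_2$ and $\epsilon^{(3)}_{\mathrm{avg}}(\chi)$. 3. Every $2$-design $\chi$ in $\mathbb{C}^d$ with $|\chi|=d^2$ satisfies $\mathcal{E}_3(\chi)\ge\frac{d+3}{d(d+1)^2}$. 4. If $\chi_{\mathrm{SIC}}$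 is a SIC in $\mathbb{C}^d$, that is, $d^2$ unit vectors with $|\langle\psi_i|\psi_j\rangle|^2=\frac1{d+1}$ for $i\ne j$, then $\chi_{\mathrm{SIC}}$ is a $2$-design, satisfies $\mathcal{E}_3(\chi_{\mathrm{SIC}})=\frac{d+3}{d(d+1)^2}$, and among all $2$-designs of size $d^2$ it minimizes $\mathcal{E}_3(\chi)$, $\|\mathcal F_3(\chi)-\rho_3\|_2$ and $\epsilon^{(3)}_{\mathrm{avg}}(\chi)$. -/

import Mathlib

noncomputable section

namespace ProjectiveDesign

open MeasureTheory

/-- The Hilbert space `ℂ^d` with its Hermitian inner product. -/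
abbrev H (d : ℕ) : Type := EuclideanSpace ℂ (Fin d)

/-- A frame in `ℂ^d`: a finite family of unit vectors, indexed by `ι`. -/
structure Frame (d : ℕ) (ι : Type*) where
  vec : ι → H d
  norm_vec : ∀ i, ‖vec i‖ = 1

/-- The `k`-frame potential `𝓔_k(χ) = N⁻² ∑_{i,j} |⟨ψ_i|ψ_j⟩|^{2k}`. -/
def framePotential {d : ℕ} {ι : Type*} [Fintype ι] (k : ℕ) (χ : Frame d ι) : ℝ :=
  1 / (Fintype.card ι : ℝ) ^ 2 * ∑ i, ∑ j, ‖inner ℂ (χ.vec i) (χ.vec j)‖ ^ (2 * k)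

/-- Lebesgue measure on `ℂ^d`. -/
def lebesgue (d : ℕ) : Measure (H d) :=
  (volume : Measure (Fin d → ℂ)).map (WithLp.toLp 2)

/-- The Haar average over pure states: the average with respect to the normalized (unitarily
invariant) surface measure of the unit sphere of `ℂ^d`. It is only applied to functions that do
not depend on the phase of the vector, that is, to functions on projective space. -/
def haarMean {d : ℕ} (f : H d → ℂ) : ℂ :=
  ⨍ φ : Metric.sphere (0 : H d) 1, f φ ∂(lebesgue d).toSphere

/-- The average over a frame, `N⁻¹ ∑ i, f(ψ_i)`. -/
def frameMean {d : ℕ} {ι : Type*} [Fintype ι] (χ : Frame d ι) (f : H d → ℂ) : ℂ :=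
  1 / (Fintype.card ι : ℂ) * ∑ i, f (χ.vec i)

/-- Bihomogeneous polynomials of degree `(k,k)`. The variables `Sum.inl i` stand for the
amplitudes, the variables `Sum.inr i` for their complex conjugates. -/
def IsBihomogeneous {d : ℕ} (k : ℕ) (p : MvPolynomial (Fin d ⊕ Fin d) ℂ) : Prop :=
  ∀ m ∈ p.support, ∑ i, m (Sum.inl i) = k ∧ ∑ i, m (Sum.inr i) = k

/-- The value of such a polynomial at a vector. -/
def evalAt {d : ℕ} (p : MvPolynomial (Fin d ⊕ Fin d) ℂ) (φ : H d) : ℂ :=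
  MvPolynomial.eval (Sum.elim (fun i => φ i) (fun i => star (φ i))) p

/-- Complex projective `k`-designs: the frame average of every bihomogeneous polynomial of degree
`(k,k)` is its Haar average. -/
def IsDesign {d : ℕ} {ι : Type*} [Fintype ι] (k : ℕ) (χ : Frame d ι) : Prop :=
  ∀ p : MvPolynomial (Fin d ⊕ Fin d) ℂ, IsBihomogeneous k p →
    haarMean (evalAt p) = frameMean χ (evalAt p)

/-- The `k`-fold tensor power of a vector, as an element of
`(ℂ^d)^{⊗k} = ℂ^(Fin k → Fin d)` (coordinates in the product basis). -/
def tensorPow {d : ℕ} (k : ℕ) (φ : H d) : EuclideanSpace ℂ (Fin k → Fin d) :=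
  WithLp.toLp 2 fun a => ∏ r, φ (a r)

/-- The frame operator `𝓕_k(χ) = N⁻¹ ∑ i, |ψ_i⟩⟨ψ_i|^{⊗k}`. -/
def frameOp {d : ℕ} {ι : Type*} [Fintype ι] (k : ℕ) (χ : Frame d ι) :
    Matrix (Fin k → Fin d) (Fin k → Fin d) ℂ :=
  (1 / (Fintype.card ι : ℂ)) •
    ∑ i, Matrix.of fun a b => tensorPow k (χ.vec i) a * star (tensorPow k (χ.vec i) b)

/-- The operator permuting the tensor factors. -/
def permOp (d : ℕ) {k : ℕ} (σ : Equiv.Perm (Fin k)) :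
    Matrix (Fin k → Fin d) (Fin k → Fin d) ℂ :=
  Matrix.of fun a b => if a = b ∘ σ.symm then 1 else 0

/-- The projector `Π_k` onto the symmetric subspace. -/
def symProj (d k : ℕ) : Matrix (Fin k → Fin d) (Fin k → Fin d) ℂ :=
  (1 / (k.factorial : ℂ)) • ∑ σ : Equiv.Perm (Fin k), permOp d σ

/-- The Haar moment operator `ρ_k = Π_k / Tr Π_k`. -/
def rho (d k : ℕ) : Matrix (Fin k → Fin d) (Fin k → Fin d) ℂ :=
  (1 / (symProj d k).trace) • symProj d k

/-- The Frobenius (Hilbert-Schmidt) norm of a matrix. -/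
def frobNorm {n : Type*} [Fintype n] (A : Matrix n n ℂ) : ℝ :=
  Real.sqrt (∑ a, ∑ b, ‖A a b‖ ^ 2)

/-- The symmetric subspace of `(ℂ^d)^{⊗k}`. -/
def symSubspace (d k : ℕ) : Submodule ℂ (EuclideanSpace ℂ (Fin k → Fin d)) where
  carrier := {v | ∀ (σ : Equiv.Perm (Fin k)) (a : Fin k → Fin d), v (a ∘ σ) = v a}
  add_mem' := by
    intro v w hv hw σ a
    simp [hv σ a, hw σ a]
  zero_mem' := by
    intro σ a
    simp
  smul_mem' := by
    intro c v hv σ a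
    simp [hv σ a]

theorem tensorPow_mem {d : ℕ} (k : ℕ) (φ : H d) : tensorPow k φ ∈ symSubspace d k := by
  intro σ a
  exact Equiv.prod_comp σ fun r => φ (a r)

/-- The tensor power of a vector as an element of the symmetric subspace. -/
def symPow {d : ℕ} (k : ℕ) (φ : H d) : symSubspace d k := ⟨tensorPow k φ, tensorPow_mem k φ⟩

/-- Operators on the symmetric subspace. -/
abbrev SymOp (d k : ℕ) : Type := symSubspace d k →ₗ[ℂ] symSubspace d k

/-- An orthonormal basis of the symmetric subspace. -/
def symBasis (d k : ℕ) :
    OrthonormalBasis (Fin (Module.finrank ℂ (symSubspace d k))) ℂ (symSubspace d k) :=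
  stdOrthonormalBasis ℂ (symSubspace d k)

/-- The polynomial function `p(φ) = ⟨φ|^{⊗k} M |φ⟩^{⊗k}` given by an operator `M`. -/
def symPoly {d k : ℕ} (M : SymOp d k) (φ : H d) : ℂ :=
  inner ℂ (symPow k φ) (M (symPow k φ))

/-- The Hilbert-Schmidt norm `‖M‖₂` of an operator on the symmetric subspace. -/
def hsNorm {d k : ℕ} (M : SymOp d k) : ℝ :=
  Real.sqrt (∑ i, ‖M (symBasis d k i)‖ ^ 2)

/-- The standard complex Gaussian law: independent real and imaginary parts of variance `1/2`. -/
def complexGaussian : Measure ℂ :=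
  ((ProbabilityTheory.gaussianReal 0 (1 / 2)).prod
    (ProbabilityTheory.gaussianReal 0 (1 / 2))).map fun z => (⟨z.1, z.2⟩ : ℂ)

/-- The Ginibre ensemble: square matrices with independent standard complex Gaussian entries. -/
def ginibre (n : Type*) [Fintype n] : Measure (n → n → ℂ) :=
  Measure.pi fun _ => Measure.pi fun _ => complexGaussian

/-- The operator on the symmetric subspace with the given matrix in the chosen orthonormal basis.
The law of this operator under `ginibre` does not depend on the basis. -/
def opOfMatrix (d k : ℕ)
    (X : Fin (Module.finrank ℂ (symSubspace d k)) →
      Fin (Module.finrank ℂ (symSubspace d k)) → ℂ) : SymOp d k :=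
  Matrix.toLin (symBasis d k).toBasis (symBasis d k).toBasis (Matrix.of X)

/-- The average error `ε_avg^{(k)}(χ)`: the root mean square, over a Ginibre-random operator `M`
on the symmetric subspace, of `‖M‖₂⁻¹ |𝔼_Haar p_M - 𝔼_χ p_M|`. -/
def avgError {d : ℕ} {ι : Type*} [Fintype ι] (k : ℕ) (χ : Frame d ι) : ℝ :=
  Real.sqrt (∫ X, (hsNorm (opOfMatrix d k X) ^ 2)⁻¹ *
      ‖haarMean (symPoly (opOfMatrix d k X)) - frameMean χ (symPoly (opOfMatrix d k X))‖ ^ 2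
    ∂(ginibre (Fin (Module.finrank ℂ (symSubspace d k)))))

/-- `χ` is an optimal approximate `k`-design among the exact `k'`-designs of its cardinality: it is
a `k'`-design, and among all `k'`-designs of the same cardinality it minimizes the frame potential
`𝓔_k`, the distance `‖𝓕_k - ρ_k‖₂`, and the average error `ε_avg^{(k)}`. -/
def IsOptimalApproxDesign {d : ℕ} {ι : Type*} [Fintype ι] (k' k : ℕ) (χ : Frame d ι) : Prop :=
  IsDesign k' χ ∧
    ∀ χ' : Frame d (Fin (Fintype.card ι)), IsDesign k' χ' →
      framePotential k χ ≤ framePotential k χ' ∧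
      frobNorm (frameOp k χ - rho d k) ≤ frobNorm (frameOp k χ' - rho d k) ∧
      avgError k χ ≤ avgError k χ'

/-- A complete set of mutually unbiased bases of `ℂ^d`. -/
structure CompleteMUB (d : ℕ) where
  basis : Fin (d + 1) → OrthonormalBasis (Fin d) ℂ (H d)
  unbiased : ∀ α β, α ≠ β → ∀ i j, ‖inner ℂ (basis α i) (basis β j)‖ ^ 2 = 1 / (d : ℝ)

/-- The frame of all `d(d+1)` vectors of a complete set of mutually unbiased bases. -/
def CompleteMUB.frame {d : ℕ} (B : CompleteMUB d) : Frame d (Fin (d + 1) × Fin d) where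
  vec x := B.basis x.1 x.2
  norm_vec x := (B.basis x.1).norm_eq_one x.2

/-- A SIC in `ℂ^d`: `d²` unit vectors with all pairwise squared overlaps equal to `1/(d+1)`. -/
def IsSIC {d : ℕ} (χ : Frame d (Fin (d ^ 2))) : Prop :=
  ∀ i j, i ≠ j → ‖inner ℂ (χ.vec i) (χ.vec j)‖ ^ 2 = 1 / ((d : ℝ) + 1)

end ProjectiveDesign

end

open ProjectiveDesign

/-!
Write `x` for a squared overlap `|⟨ψ_i|ψ_j⟩|²`. Since `x (x - t)² ≥ 0`, dropping all but the
diagonal terms from the sum of these quantities over all pairs gives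
`𝓔₃ ≥ 2 t 𝓔₂ - t² 𝓔₁ + (1 - t)² / N`, with equality when every off-diagonal `x` is `0` or `t`. For a
`1`-design `𝓔₁ = 1 / d`, and `𝓔₂ ≥ 2 / (d (d + 1))` by the Welch bound, so `t = 1 / d` and
`t = 1 / (d + 1)` yield the bounds attained by mutually unbiased bases and by SICs.

The Welch bound is the nonnegativity of `‖𝓕_k - ρ_k‖₂² = 𝓔_k - 1 / Tr Π_k`. Equality characterizes
`k`-designs because the Haar average of `(|φ⟩⟨φ|)^{⊗k}` is `ρ_k`: in polar coordinates this average
is proportional to a Gaussian integral over `ℂ^d`, which splits into one-dimensional moments.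

Finally, for a vector `x` of independent coordinates with a symmetric law without atoms, the average
of `x x* / ‖x‖²` is a multiple of the identity. Hence `ε_avg` is a multiple of `‖𝓕_k - ρ_k‖₂`, and a
frame minimizing `𝓔_k` minimizes all three figures of merit.
-/

noncomputable section

namespace ProjectiveDesign

open MeasureTheory Module
open scoped Matrix

variable {d k : ℕ} {ι : Type*}

theorem Frame.neZero [Nonempty ι] (χ : Frame d ι) : NeZero d := by
  refine ⟨?_⟩
  rintro rfl
  have zero_eq_one := χ.norm_vec (Classical.arbitrary ι)
  rw [Subsingleton.elim (χ.vec _) 0, norm_zero] at zero_eq_one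
  exact zero_ne_one zero_eq_one

variable [Fintype ι]

/-- The `k`-fold tensor power `(|φ⟩⟨φ|)^{⊗k}`, as a matrix in the product basis. -/
def tensorProj (k : ℕ) (φ : H d) : Matrix (Fin k → Fin d) (Fin k → Fin d) ℂ :=
  Matrix.vecMulVec (tensorPow k φ).ofLp (star (tensorPow k φ).ofLp)

theorem tensorProj_apply (φ : H d) (a b : Fin k → Fin d) :
    tensorProj k φ a b = (∏ r, φ (a r)) * ∏ r, star (φ (b r)) := by
  simp [tensorProj, tensorPow, Matrix.vecMulVec_apply]

theorem frameOp_eq_smul_sum (k : ℕ) (χ : Frame d ι) :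
    frameOp k χ = (1 / (Fintype.card ι : ℂ)) • ∑ i, tensorProj k (χ.vec i) :=
  rfl

theorem inner_tensorPow (k : ℕ) (φ ψ : H d) :
    inner ℂ (tensorPow k φ) (tensorPow k ψ) = inner ℂ φ ψ ^ k := by
  simp only [tensorPow, PiLp.inner_apply, RCLike.inner_apply, map_prod, ← Finset.prod_mul_distrib]
  exact (Finset.sum_pow' Finset.univ (fun i => ψ i * (starRingEnd ℂ) (φ i)) k).symm

theorem trace_tensorProj_mul_tensorProj (φ ψ : H d) :
    (tensorProj k φ * tensorProj k ψ).trace = ((‖inner ℂ φ ψ‖ ^ (2 * k) : ℝ) : ℂ) := by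
  have inner_eq (φ ψ : H d) :
      star (tensorPow k φ).ofLp ⬝ᵥ (tensorPow k ψ).ofLp = inner ℂ φ ψ ^ k := by
    rw [← inner_tensorPow, EuclideanSpace.inner_eq_star_dotProduct, dotProduct_comm]
  rw [tensorProj, tensorProj, Matrix.vecMulVec_mul_vecMulVec, Matrix.trace_vecMulVec,
    dotProduct_smul, dotProduct_comm _ (star _), inner_eq, inner_eq, smul_eq_mul, ← mul_pow,
    ← inner_conj_symm ψ φ, RCLike.mul_conj, pow_mul]
  norm_cast

theorem trace_tensorProj {φ : H d} (hφ : ‖φ‖ = 1) : (tensorProj k φ).trace = 1 := by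
  rw [tensorProj, Matrix.trace_vecMulVec, ← EuclideanSpace.inner_eq_star_dotProduct,
    inner_tensorPow, inner_self_eq_norm_sq_to_K, hφ]
  simp

theorem isHermitian_tensorProj (φ : H d) : (tensorProj k φ).IsHermitian := by
  rw [Matrix.IsHermitian, tensorProj, Matrix.conjTranspose_vecMulVec, star_star]

theorem isHermitian_frameOp (χ : Frame d ι) : (frameOp k χ).IsHermitian := by
  simp [Matrix.IsHermitian, frameOp_eq_smul_sum, Matrix.conjTranspose_sum,
    (isHermitian_tensorProj _).eq]

theorem trace_frameOp [Nonempty ι] (χ : Frame d ι) : (frameOp k χ).trace = 1 := by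
  simp [frameOp_eq_smul_sum, Matrix.trace_sum, trace_tensorProj (χ.norm_vec _)]

theorem trace_frameOp_mul_frameOp (χ : Frame d ι) :
    (frameOp k χ * frameOp k χ).trace = (framePotential k χ : ℂ) := by
  simp only [frameOp_eq_smul_sum, framePotential, Matrix.smul_mul, Matrix.mul_smul, smul_smul,
    Matrix.trace_smul, Finset.sum_mul_sum, Matrix.trace_sum, trace_tensorProj_mul_tensorProj]
  push_cast
  rw [smul_eq_mul, sq, one_div_mul_one_div]

/-! ### The symmetric projector -/

theorem permOp_mul_apply {m : Type*} (σ : Equiv.Perm (Fin k)) (A : Matrix (Fin k → Fin d) m ℂ)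
    (a : Fin k → Fin d) (b : m) : (permOp d σ * A) a b = A (a ∘ σ) b := by
  have eq_iff (c : Fin k → Fin d) : a = c ∘ σ.symm ↔ c = a ∘ σ := by
    rw [Equiv.eq_comp_symm, eq_comm]
  simp [Matrix.mul_apply, permOp, eq_iff]

theorem permOp_mul_permOp (σ τ : Equiv.Perm (Fin k)) :
    permOp d σ * permOp d τ = permOp d (σ * τ) := by
  ext a b
  rw [permOp_mul_apply]
  simp only [permOp, Matrix.of_apply, Equiv.eq_comp_symm]
  rfl

theorem conjTranspose_permOp (σ : Equiv.Perm (Fin k)) : (permOp d σ)ᴴ = permOp d σ⁻¹ := by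
  ext a b
  have eq_iff : b = a ∘ σ.symm ↔ a = b ∘ σ := by rw [Equiv.eq_comp_symm, eq_comm]
  simp [permOp, eq_iff, apply_ite (star (R := ℂ)), Equiv.Perm.inv_def]

theorem permOp_mul_tensorProj (σ : Equiv.Perm (Fin k)) (φ : H d) :
    permOp d σ * tensorProj k φ = tensorProj k φ := by
  ext a b
  rw [permOp_mul_apply, tensorProj_apply, tensorProj_apply]
  congr 1
  exact Equiv.prod_comp σ fun r => φ (a r)

theorem permOp_mul_symProj (σ : Equiv.Perm (Fin k)) : permOp d σ * symProj d k = symProj d k := by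
  simp only [symProj, Matrix.mul_smul, Finset.mul_sum, permOp_mul_permOp]
  congr 1
  exact Equiv.sum_comp (Equiv.mulLeft σ) (permOp d)

theorem isHermitian_symProj (d k : ℕ) : (symProj d k).IsHermitian := by
  simp only [Matrix.IsHermitian, symProj, Matrix.conjTranspose_smul, Matrix.conjTranspose_sum,
    conjTranspose_permOp]
  congr 1
  · simp
  · exact Equiv.sum_comp (Equiv.inv _) (permOp d)

theorem symProj_mul_eq_self {m : Type*} {A : Matrix (Fin k → Fin d) m ℂ}
    (hA : ∀ σ : Equiv.Perm (Fin k), permOp d σ * A = A) : symProj d k * A = A := by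
  simp [symProj, Matrix.sum_mul, hA, Fintype.card_perm, ← Nat.cast_smul_eq_nsmul ℂ,
    Nat.factorial_ne_zero]

theorem symProj_mul_symProj (d k : ℕ) : symProj d k * symProj d k = symProj d k :=
  symProj_mul_eq_self permOp_mul_symProj

theorem symProj_mul_frameOp (χ : Frame d ι) : symProj d k * frameOp k χ = frameOp k χ := by
  simp [frameOp_eq_smul_sum, Finset.mul_sum, symProj_mul_eq_self (permOp_mul_tensorProj · _)]

theorem symProj_mul_rho (d k : ℕ) : symProj d k * rho d k = rho d k := by
  rw [rho, Matrix.mul_smul, symProj_mul_symProj]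

/-- The occupation number of `i` in the index tuple `a`: how many tensor factors are in the basis
state `i`. -/
def occupation (a : Fin k → Fin d) (i : Fin d) : ℕ :=
  Fintype.card {r // a r = i}

theorem exists_comp_perm_eq_iff {a b : Fin k → Fin d} :
    (∃ σ : Equiv.Perm (Fin k), b ∘ σ = a) ↔ occupation a = occupation b := by
  constructor
  · rintro ⟨σ, rfl⟩
    ext i
    exact Fintype.card_congr (Equiv.subtypeEquiv σ fun _ => Iff.rfl)
  · intro h
    exact ⟨Equiv.ofFiberEquiv fun i => Fintype.equivOfCardEq (congrFun h i),
      funext (Equiv.ofFiberEquiv_map _)⟩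

theorem coe_ofFn_eq_iff {a b : Fin k → Fin d} :
    (List.ofFn a : Multiset (Fin d)) = List.ofFn b ↔ occupation a = occupation b := by
  have count_eq (c : Fin k → Fin d) (i : Fin d) :
      (List.ofFn c : Multiset (Fin d)).count i = occupation c i := by
    rw [← Fin.univ_val_map, Multiset.count_map, occupation, Fintype.card_subtype]
    simp only [eq_comm, Finset.card_def, Finset.filter_val]
  simp only [Multiset.ext, count_eq, funext_iff]

theorem symProj_apply (a b : Fin k → Fin d) :
    symProj d k a b =
      (Fintype.card {σ : Equiv.Perm (Fin k) // b ∘ σ = a} : ℂ) / (k.factorial : ℂ) := by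
  have reindex := Equiv.sum_comp (Equiv.inv (Equiv.Perm (Fin k))) (permOp d · a b)
  simp only [symProj, Matrix.smul_apply, Matrix.sum_apply, smul_eq_mul, ← reindex]
  simp [permOp, Fintype.card_subtype, eq_comm, Equiv.Perm.inv_def, div_eq_inv_mul]

theorem symProj_apply_eq_prod (a b : Fin k → Fin d) :
    symProj d k a b = (∏ i, if occupation a i = occupation b i then
      ((occupation b i).factorial : ℂ) else 0) / (k.factorial : ℂ) := by
  rw [symProj_apply]
  congr 1
  by_cases h : ∃ σ : Equiv.Perm (Fin k), b ∘ σ = a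
  · obtain ⟨τ, rfl⟩ := h
    have same_occupation : occupation (b ∘ τ) = occupation b := exists_comp_perm_eq_iff.1 ⟨τ, rfl⟩
    have translate : {σ : Equiv.Perm (Fin k) // b ∘ σ = b} ≃
        {σ : Equiv.Perm (Fin k) // b ∘ σ = b ∘ τ} :=
      (Equiv.mulRight τ).subtypeEquiv fun σ => (τ.surjective.injective_comp_right.eq_iff
        (a := b ∘ σ) (b := b)).symm
    rw [← Fintype.card_congr translate, DomMulAct.stabilizer_card, Nat.cast_prod]
    simp only [same_occupation, if_true]
    rfl
  · have : IsEmpty {σ : Equiv.Perm (Fin k) // b ∘ σ = a} := ⟨fun σ => h ⟨σ, σ.2⟩⟩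
    obtain ⟨i, hi⟩ := Function.ne_iff.1 (mt exists_comp_perm_eq_iff.2 h)
    rw [Finset.prod_eq_zero (Finset.mem_univ i) (if_neg hi), Fintype.card_eq_zero, Nat.cast_zero]

theorem card_orbits_comp_perm (d k : ℕ)
    [Fintype (Quotient (MulAction.orbitRel (Equiv.Perm (Fin k))ᵈᵐᵃ (Fin k → Fin d)))] :
    Fintype.card (Quotient (MulAction.orbitRel (Equiv.Perm (Fin k))ᵈᵐᵃ (Fin k → Fin d))) =
      d.multichoose k := by
  let content (a : Fin k → Fin d) : Sym (Fin d) k := ⟨List.ofFn a, by simp⟩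
  have content_eq_iff (a b : Fin k → Fin d) : content a = content b ↔ occupation a = occupation b :=
    Subtype.ext_iff.trans coe_ofFn_eq_iff
  have orbit_iff (a b : Fin k → Fin d) :
      MulAction.orbitRel (Equiv.Perm (Fin k))ᵈᵐᵃ (Fin k → Fin d) a b ↔ content a = content b := by
    rw [content_eq_iff, ← exists_comp_perm_eq_iff]
    exact DomMulAct.mk.symm.exists_congr_left
  let content' := Quotient.lift content fun a b => (orbit_iff a b).1
  have bijective : Function.Bijective content' := by
    constructor
    · rintro ⟨a⟩ ⟨b⟩ h
      exact Quotient.sound ((orbit_iff a b).2 h)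
    · rintro ⟨⟨l⟩, hl⟩
      obtain rfl : l.length = k := hl
      exact ⟨⟦l.get⟧, Subtype.ext (congrArg Multiset.ofList (List.ofFn_get l))⟩
  rw [Fintype.card_of_bijective bijective, Sym.card_sym_eq_multichoose, Fintype.card_fin]

theorem trace_symProj (d k : ℕ) : (symProj d k).trace = d.multichoose k := by
  classical
  let _ : Fintype (Equiv.Perm (Fin k))ᵈᵐᵃ := Fintype.ofEquiv _ DomMulAct.mk
  have trace_permOp (σ : Equiv.Perm (Fin k)) : (permOp d σ).trace =
      Fintype.card (MulAction.fixedBy (Fin k → Fin d) (DomMulAct.mk σ⁻¹)) := by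
    have fixed_iff (a : Fin k → Fin d) :
        a ∈ MulAction.fixedBy (Fin k → Fin d) (DomMulAct.mk σ⁻¹) ↔ a = a ∘ σ.symm := eq_comm
    simp only [Matrix.trace, Matrix.diag, permOp, Matrix.of_apply, Finset.sum_boole,
      Fintype.card_subtype, fixed_iff]
  have burnside := MulAction.sum_card_fixedBy_eq_card_orbits_mul_card_group
    (Equiv.Perm (Fin k))ᵈᵐᵃ (Fin k → Fin d)
  rw [card_orbits_comp_perm, ← Fintype.card_congr DomMulAct.mk, Fintype.card_perm,
    Fintype.card_fin, ← Equiv.sum_comp (DomMulAct.mk (M := Equiv.Perm (Fin k))),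
    ← Equiv.sum_comp (Equiv.inv (Equiv.Perm (Fin k)))] at burnside
  rw [symProj, Matrix.trace_smul, Matrix.trace_sum, Finset.sum_congr rfl fun σ _ => trace_permOp σ,
    ← Nat.cast_sum]
  have : (k.factorial : ℂ) ≠ 0 := by exact_mod_cast k.factorial_ne_zero
  refine (congrArg (fun m : ℕ => (1 / (k.factorial : ℂ)) • (m : ℂ)) burnside).trans ?_
  push_cast
  simp only [smul_eq_mul]
  field_simp

theorem trace_symProj_ne_zero [NeZero d] : (symProj d k).trace ≠ 0 := by
  rw [trace_symProj, Nat.cast_ne_zero, Nat.multichoose_eq]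
  exact (Nat.choose_pos (by have := NeZero.pos d; omega)).ne'

theorem isHermitian_rho (d k : ℕ) : (rho d k).IsHermitian := by
  rw [Matrix.IsHermitian, rho, Matrix.conjTranspose_smul, (isHermitian_symProj d k).eq,
    trace_symProj]
  simp

theorem trace_rho [NeZero d] : (rho d k).trace = 1 := by
  rw [rho, Matrix.trace_smul, smul_eq_mul, one_div_mul_cancel trace_symProj_ne_zero]

theorem frobNorm_nonneg {n : Type*} [Fintype n] (A : Matrix n n ℂ) : 0 ≤ frobNorm A :=
  Real.sqrt_nonneg _

theorem frobNorm_sq {n : Type*} [Fintype n] (A : Matrix n n ℂ) :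
    frobNorm A ^ 2 = ∑ a, ∑ b, ‖A a b‖ ^ 2 :=
  Real.sq_sqrt (by positivity)

theorem frobNorm_sq_eq_trace {n : Type*} [Fintype n] (A : Matrix n n ℂ) :
    ((frobNorm A ^ 2 : ℝ) : ℂ) = (A * Aᴴ).trace := by
  simp [frobNorm_sq, Matrix.trace, Matrix.mul_apply, RCLike.mul_conj]

theorem frobNorm_eq_zero_iff {n : Type*} [Fintype n] {A : Matrix n n ℂ} :
    frobNorm A = 0 ↔ A = 0 := by
  rw [← pow_eq_zero_iff two_ne_zero, frobNorm_sq,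
    Finset.sum_eq_zero_iff_of_nonneg fun _ _ => by positivity]
  simp [Finset.sum_eq_zero_iff_of_nonneg, ← Matrix.ext_iff]

theorem frobNorm_frameOp_sub_rho_sq [Nonempty ι] (χ : Frame d ι) :
    frobNorm (frameOp k χ - rho d k) ^ 2 = framePotential k χ - 1 / (d.multichoose k : ℝ) := by
  have := χ.neZero
  have mul_rho {A : Matrix (Fin k → Fin d) (Fin k → Fin d) ℂ} (hA : symProj d k * A = A)
      (trace_eq : A.trace = 1) : (A * rho d k).trace = 1 / (symProj d k).trace := by
    rw [Matrix.trace_mul_comm, rho, Matrix.smul_mul, hA, Matrix.trace_smul, trace_eq, smul_eq_mul,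
      mul_one]
  have frame_rho := mul_rho (symProj_mul_frameOp χ) (trace_frameOp χ)
  have rho_rho := mul_rho (symProj_mul_rho d k) trace_rho
  rw [← Complex.ofReal_inj, frobNorm_sq_eq_trace,
    ((isHermitian_frameOp χ).sub (isHermitian_rho d k)).eq, sub_mul, mul_sub, mul_sub,
    Matrix.trace_sub, Matrix.trace_sub, Matrix.trace_sub,
    Matrix.trace_mul_comm (rho d k) (frameOp k χ), frame_rho, rho_rho, trace_frameOp_mul_frameOp,
    trace_symProj]
  push_cast
  ring

theorem frameOp_eq_rho_iff [Nonempty ι] {χ : Frame d ι} :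
    frameOp k χ = rho d k ↔ framePotential k χ = 1 / (d.multichoose k : ℝ) := by
  rw [← sub_eq_zero, ← frobNorm_eq_zero_iff, ← pow_eq_zero_iff two_ne_zero,
    frobNorm_frameOp_sub_rho_sq, sub_eq_zero]

theorem one_div_multichoose_le_framePotential [Nonempty ι] (χ : Frame d ι) :
    1 / (d.multichoose k : ℝ) ≤ framePotential k χ := by
  rw [← sub_nonneg, ← frobNorm_frameOp_sub_rho_sq]
  positivity

/-! ### Haar averages -/

theorem integral_monomial_mul_exp_of_ne {m n : ℕ} (h : m ≠ n) :
    ∫ z : ℂ, z ^ m * star z ^ n * (Real.exp (-‖z‖ ^ 2) : ℂ) = 0 := by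
  -- Rotation by `π / (m - n)` preserves the measure and negates the integrand.
  have sub_ne_zero : (m : ℂ) - n ≠ 0 := sub_ne_zero.2 (by exact_mod_cast h)
  let u : Circle := Circle.exp (Real.pi / ((m : ℝ) - n))
  have phase : (u : ℂ) ^ m * star (u : ℂ) ^ n = -1 := by
    rw [Circle.coe_exp, Complex.star_def, ← Complex.exp_conj, ← Complex.exp_nat_mul,
      ← Complex.exp_nat_mul, ← Complex.exp_add, ← Complex.exp_pi_mul_I]
    congr 1
    simp only [map_mul, Complex.conj_ofReal, Complex.conj_I]
    push_cast
    field_simp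
    ring
  have rotated (z : ℂ) : rotation u z ^ m * star (rotation u z) ^ n *
      (Real.exp (-‖rotation u z‖ ^ 2) : ℂ) =
      -(z ^ m * star z ^ n * (Real.exp (-‖z‖ ^ 2) : ℂ)) := by
    rw [LinearIsometryEquiv.norm_map, rotation_apply, star_mul', mul_pow, mul_pow]
    linear_combination (z ^ m * star z ^ n * (Real.exp (-‖z‖ ^ 2) : ℂ)) * phase
  have invariance := (rotation u).measurePreserving.integral_comp
    (rotation u).toHomeomorph.measurableEmbedding
    (fun z : ℂ => z ^ m * star z ^ n * (Real.exp (-‖z‖ ^ 2) : ℂ))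
  simp only [rotated, integral_neg] at invariance
  exact self_eq_neg.1 invariance.symm

theorem integral_monomial_mul_exp_self (m : ℕ) :
    ∫ z : ℂ, z ^ m * star z ^ m * (Real.exp (-‖z‖ ^ 2) : ℂ) = Real.pi * m.factorial := by
  have radial (z : ℂ) : z ^ m * star z ^ m * (Real.exp (-‖z‖ ^ 2) : ℂ) =
      ((‖z‖ ^ (2 * m : ℝ) * Real.exp (-‖z‖ ^ (2 : ℝ)) : ℝ) : ℂ) := by
    rw [← mul_pow, Complex.star_def, Complex.mul_conj', Real.rpow_mul (norm_nonneg z),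
      Real.rpow_natCast, Real.rpow_two]
    push_cast
    rfl
  simp only [radial]
  rw [integral_complex_ofReal, Complex.integral_rpow_mul_exp_neg_rpow (by norm_num)
    (by linarith [m.cast_nonneg (α := ℝ)]), show (2 * m + 2 : ℝ) / 2 = m + 1 by ring,
    Real.Gamma_nat_eq_factorial]
  push_cast
  ring

theorem integral_monomial_mul_exp (m n : ℕ) :
    ∫ z : ℂ, z ^ m * star z ^ n * (Real.exp (-‖z‖ ^ 2) : ℂ) =
      Real.pi * if m = n then (n.factorial : ℂ) else 0 := by
  split_ifs with h
  · rw [h, integral_monomial_mul_exp_self]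
  · rw [integral_monomial_mul_exp_of_ne h, mul_zero]

theorem prod_comp_eq_prod_pow_occupation {M : Type*} [CommMonoid M] (f : Fin d → M)
    (a : Fin k → Fin d) : ∏ r, f (a r) = ∏ i, f i ^ occupation a i := by
  simp only [occupation, Fintype.card_subtype, ← Finset.prod_const]
  rw [← Finset.prod_fiberwise Finset.univ a]
  exact Finset.prod_congr rfl fun i _ => Finset.prod_congr rfl fun r hr =>
    congrArg f (Finset.mem_filter.1 hr).2

instance isAddHaarMeasure_lebesgue (d : ℕ) : (lebesgue d).IsAddHaarMeasure :=
  (PiLp.continuousLinearEquiv 2 ℝ (fun _ : Fin d => ℂ)).symm.isAddHaarMeasure_map volume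

theorem integral_tensorProj_mul_exp (a b : Fin k → Fin d) :
    ∫ φ, tensorProj k φ a b * (Real.exp (-‖φ‖ ^ 2) : ℂ) ∂(lebesgue d) =
      (Real.pi : ℂ) ^ d * k.factorial * symProj d k a b := by
  have factorial_ne_zero : (k.factorial : ℂ) ≠ 0 := by exact_mod_cast k.factorial_ne_zero
  have factorize (x : Fin d → ℂ) :
      tensorProj k (WithLp.toLp 2 x) a b * (Real.exp (-‖WithLp.toLp 2 x‖ ^ 2) : ℂ) =
        ∏ i, (x i ^ occupation a i * star (x i) ^ occupation b i *
          (Real.exp (-‖x i‖ ^ 2) : ℂ)) := by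
    simp only [tensorProj_apply, prod_comp_eq_prod_pow_occupation x,
      prod_comp_eq_prod_pow_occupation (fun i => star (x i)), EuclideanSpace.norm_sq_eq,
      ← Finset.sum_neg_distrib, Real.exp_sum, Complex.ofReal_prod, Finset.prod_mul_distrib]
  rw [lebesgue, ← MeasurableEquiv.coe_toLp, integral_map_equiv]
  simp only [MeasurableEquiv.coe_toLp, factorize]
  rw [integral_fintype_prod_volume_eq_prod fun i (z : ℂ) =>
    z ^ occupation a i * star z ^ occupation b i * (Real.exp (-‖z‖ ^ 2) : ℂ)]
  simp only [integral_monomial_mul_exp, Finset.prod_mul_distrib, symProj_apply_eq_prod]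
  simp [mul_assoc, mul_div_cancel₀ _ factorial_ne_zero]

theorem integral_homogeneous_mul_norm {E : Type*} [NormedAddCommGroup E] [NormedSpace ℝ E]
    [FiniteDimensional ℝ E] [Nontrivial E] [MeasurableSpace E] [BorelSpace E] (μ : Measure E)
    [μ.IsAddHaarMeasure] {f : E → ℂ} {n : ℕ} (hf : ∀ (r : ℝ) x, f (r • x) = r ^ n * f x)
    (g : ℝ → ℂ) :
    ∫ x, f x * g ‖x‖ ∂μ = (∫ x : Metric.sphere (0 : E) 1, f x ∂μ.toSphere) *
      ∫ r : Set.Ioi (0 : ℝ), (r : ℂ) ^ n * g r ∂(Measure.volumeIoiPow (finrank ℝ E - 1)) := by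
  rw [← integral_prod_mul, ← μ.measurePreserving_homeomorphUnitSphereProd.integral_comp
    (Homeomorph.measurableEmbedding _)]
  conv_lhs => rw [← restrict_compl_singleton (μ := μ) 0,
    ← integral_subtype_comap (measurableSet_singleton _).compl]
  congr 1
  ext x
  rw [homeomorphUnitSphereProd_apply_snd_coe, homeomorphUnitSphereProd_apply_fst_coe, ← mul_assoc,
    mul_comm (f (_ • _)), ← hf, smul_inv_smul₀ (norm_ne_zero_iff.2 x.2)]

theorem tensorProj_smul (r : ℝ) (φ : H d) (a b : Fin k → Fin d) :
    tensorProj k (r • φ) a b = (r : ℂ) ^ (2 * k) * tensorProj k φ a b := by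
  simp only [tensorProj_apply, PiLp.smul_apply, Complex.real_smul, star_mul', Complex.star_def,
    Complex.conj_ofReal, Finset.prod_mul_distrib, Finset.prod_const, Finset.card_univ,
    Fintype.card_fin]
  ring

theorem continuous_tensorProj_apply (a b : Fin k → Fin d) :
    Continuous fun φ => tensorProj k φ a b := by
  simp only [tensorProj_apply]
  fun_prop

theorem haarMean_const [NeZero d] (c : ℂ) : haarMean (fun _ : H d => c) = c := by
  have : NeZero (lebesgue d).toSphere := ⟨(lebesgue d).toSphere_ne_zero⟩
  exact average_const _ c

theorem haarMean_const_mul (c : ℂ) (f : H d → ℂ) :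
    haarMean (fun φ => c * f φ) = c * haarMean f := by
  simp only [haarMean, average_eq, integral_const_mul, mul_smul_comm]

theorem haarMean_finset_sum {T : Type*} (s : Finset T) {f : T → H d → ℂ}
    (hf : ∀ t, Continuous (f t)) :
    haarMean (fun φ => ∑ t ∈ s, f t φ) = ∑ t ∈ s, haarMean (f t) := by
  simp only [haarMean, average_eq, ← Finset.smul_sum]
  rw [integral_finsetSum]
  exact fun t _ => ((hf t).comp continuous_subtype_val).integrable_of_hasCompactSupport
    (HasCompactSupport.of_compactSpace _)

theorem haarMean_congr {f g : H d → ℂ} (h : ∀ φ, ‖φ‖ = 1 → f φ = g φ) :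
    haarMean f = haarMean g := by
  simp only [haarMean, h _ (norm_eq_of_mem_sphere _)]

theorem exists_haarMean_tensorProj_eq_const_mul [NeZero d] (k : ℕ) :
    ∃ c : ℂ, ∀ a b : Fin k → Fin d,
      haarMean (fun φ => tensorProj k φ a b) = c * symProj d k a b := by
  let R : ℂ := ∫ r : Set.Ioi (0 : ℝ), (r : ℂ) ^ (2 * k) * (Real.exp (-(r : ℝ) ^ 2) : ℂ)
    ∂(Measure.volumeIoiPow (finrank ℝ (H d) - 1))
  have polar (a b : Fin k → Fin d) : (Real.pi : ℂ) ^ d * k.factorial * symProj d k a b =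
      (∫ φ : Metric.sphere (0 : H d) 1, tensorProj k φ a b ∂(lebesgue d).toSphere) * R := by
    rw [← integral_tensorProj_mul_exp]
    exact integral_homogeneous_mul_norm (lebesgue d) (fun r φ => tensorProj_smul r φ a b)
      fun r => (Real.exp (-r ^ 2) : ℂ)
  have R_ne_zero : R ≠ 0 := by
    intro R_eq_zero
    refine trace_symProj_ne_zero (d := d) (k := k) (Finset.sum_eq_zero fun a _ => ?_)
    have vanish := polar a a
    rw [R_eq_zero, mul_zero] at vanish
    simpa [Nat.factorial_ne_zero, Real.pi_ne_zero] using vanish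
  refine ⟨((lebesgue d).toSphere.real Set.univ)⁻¹ * ((Real.pi : ℂ) ^ d * k.factorial) / R,
    fun a b => ?_⟩
  rw [haarMean, average_eq, Complex.real_smul, Complex.ofReal_inv,
    eq_div_of_mul_eq R_ne_zero (polar a b).symm]
  ring

theorem haarMean_tensorProj [NeZero d] (a b : Fin k → Fin d) :
    haarMean (fun φ => tensorProj k φ a b) = rho d k a b := by
  obtain ⟨c, hc⟩ := exists_haarMean_tensorProj_eq_const_mul (d := d) k
  have trace_eq_one : c * (symProj d k).trace = 1 := by
    simp only [Matrix.trace, Matrix.diag, Finset.mul_sum, ← hc]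
    rw [← haarMean_finset_sum _ fun a => continuous_tensorProj_apply a a]
    exact (haarMean_congr fun φ hφ => trace_tensorProj hφ).trans (haarMean_const 1)
  rw [hc, rho, Matrix.smul_apply, smul_eq_mul, eq_one_div_of_mul_eq_one_left trace_eq_one]

theorem haarMean_trace_mul_tensorProj [NeZero d] (M : Matrix (Fin k → Fin d) (Fin k → Fin d) ℂ) :
    haarMean (fun φ => (M * tensorProj k φ).trace) = (M * rho d k).trace := by
  simp only [Matrix.trace, Matrix.diag, Matrix.mul_apply, ← haarMean_tensorProj,
    ← haarMean_const_mul]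
  have continuous_term (a b : Fin k → Fin d) : Continuous fun φ => M a b * tensorProj k φ b a :=
    continuous_const.mul (continuous_tensorProj_apply b a)
  rw [haarMean_finset_sum _ fun a => by fun_prop]
  exact Finset.sum_congr rfl fun a _ => haarMean_finset_sum _ (continuous_term a)

theorem frameMean_trace_mul_tensorProj (χ : Frame d ι)
    (M : Matrix (Fin k → Fin d) (Fin k → Fin d) ℂ) :
    frameMean χ (fun φ => (M * tensorProj k φ).trace) = (M * frameOp k χ).trace := by
  rw [frameOp_eq_smul_sum, Matrix.mul_smul, Matrix.trace_smul, Finset.mul_sum, Matrix.trace_sum,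
    frameMean, smul_eq_mul]

/-! ### Designs -/

theorem isBihomogeneous_iff_isWeightedHomogeneous {p : MvPolynomial (Fin d ⊕ Fin d) ℂ} :
    IsBihomogeneous k p ↔
      p.IsWeightedHomogeneous (Sum.elim (fun _ => (1, 0)) fun _ => (0, 1) : _ → ℕ × ℕ) (k, k) := by
  simp only [IsBihomogeneous, MvPolynomial.IsWeightedHomogeneous, MvPolynomial.mem_support_iff]
  refine forall_congr' fun m => imp_congr_right fun _ => ?_
  simp [Finsupp.weight_apply, Finsupp.sum_fintype, Prod.ext_iff, Prod.fst_sum, Prod.snd_sum]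

theorem IsBihomogeneous.mul {l : ℕ} {p q : MvPolynomial (Fin d ⊕ Fin d) ℂ}
    (hp : IsBihomogeneous k p) (hq : IsBihomogeneous l q) : IsBihomogeneous (k + l) (p * q) := by
  rw [isBihomogeneous_iff_isWeightedHomogeneous] at *
  exact hp.mul hq

theorem IsBihomogeneous.pow {p : MvPolynomial (Fin d ⊕ Fin d) ℂ} (hp : IsBihomogeneous k p)
    (n : ℕ) : IsBihomogeneous (n * k) (p ^ n) := by
  rw [isBihomogeneous_iff_isWeightedHomogeneous] at *
  simpa using hp.pow n

theorem IsBihomogeneous.sum {T : Type*} {s : Finset T} {p : T → MvPolynomial (Fin d ⊕ Fin d) ℂ}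
    (hp : ∀ t ∈ s, IsBihomogeneous k (p t)) : IsBihomogeneous k (∑ t ∈ s, p t) := by
  rw [isBihomogeneous_iff_isWeightedHomogeneous]
  exact MvPolynomial.IsWeightedHomogeneous.sum s p _ fun t ht =>
    isBihomogeneous_iff_isWeightedHomogeneous.1 (hp t ht)

/-- The monomial whose value at `φ` is the matrix entry of `tensorProj k φ` at `(a, b)`. -/
def entryPoly (a b : Fin k → Fin d) : MvPolynomial (Fin d ⊕ Fin d) ℂ :=
  (∏ r, MvPolynomial.X (Sum.inl (a r))) * ∏ r, MvPolynomial.X (Sum.inr (b r))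

theorem isBihomogeneous_entryPoly (a b : Fin k → Fin d) : IsBihomogeneous k (entryPoly a b) := by
  let w : Fin d ⊕ Fin d → ℕ × ℕ := Sum.elim (fun _ => (1, 0)) fun _ => (0, 1)
  have left := MvPolynomial.IsWeightedHomogeneous.prod Finset.univ _ _ fun r _ =>
    MvPolynomial.isWeightedHomogeneous_X ℂ w (Sum.inl (a r))
  have right := MvPolynomial.IsWeightedHomogeneous.prod Finset.univ _ _ fun r _ =>
    MvPolynomial.isWeightedHomogeneous_X ℂ w (Sum.inr (b r))
  rw [isBihomogeneous_iff_isWeightedHomogeneous]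
  simpa [w, entryPoly] using left.mul right

theorem evalAt_entryPoly (a b : Fin k → Fin d) :
    evalAt (entryPoly a b) = fun φ => tensorProj k φ a b := by
  ext φ
  simp [evalAt, entryPoly, tensorProj_apply]

theorem exists_occupation_eq {m : Fin d → ℕ} (hm : ∑ i, m i = k) :
    ∃ a : Fin k → Fin d, occupation a = m := by
  have e : Fin k ≃ Σ i, Fin (m i) := Fintype.equivOfCardEq (by simp [hm])
  refine ⟨fun r => (e r).1, funext fun i => ?_⟩
  rw [occupation, Fintype.card_congr (e.subtypeEquiv (q := fun x => x.1 = i) fun _ => Iff.rfl),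
    Fintype.card_congr (Equiv.sigmaSubtype i), Fintype.card_fin]

theorem exists_evalAt_eq_trace_mul_tensorProj {p : MvPolynomial (Fin d ⊕ Fin d) ℂ}
    (hp : IsBihomogeneous k p) :
    ∃ M : Matrix (Fin k → Fin d) (Fin k → Fin d) ℂ,
      evalAt p = fun φ => (M * tensorProj k φ).trace := by
  have monomial (m : Fin d ⊕ Fin d →₀ ℕ) (hm : m ∈ p.support) :
      ∃ M : Matrix (Fin k → Fin d) (Fin k → Fin d) ℂ, ∀ φ : H d, (M * tensorProj k φ).trace =
        (∏ i, φ i ^ m (Sum.inl i)) * ∏ i, star (φ i) ^ m (Sum.inr i) := by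
    obtain ⟨a, ha⟩ := exists_occupation_eq (hp m hm).1
    obtain ⟨b, hb⟩ := exists_occupation_eq (hp m hm).2
    refine ⟨Matrix.single b a 1, fun φ => ?_⟩
    rw [Matrix.trace_single_mul, one_smul, tensorProj_apply, prod_comp_eq_prod_pow_occupation,
      prod_comp_eq_prod_pow_occupation fun i => star (φ i), ha, hb]
  choose! M hM using monomial
  refine ⟨∑ m ∈ p.support, p.coeff m • M m, funext fun φ => ?_⟩
  rw [Finset.sum_mul, Matrix.trace_sum, evalAt, MvPolynomial.eval_eq']
  refine Finset.sum_congr rfl fun m hm => ?_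
  rw [Matrix.smul_mul, Matrix.trace_smul, hM m hm, Fintype.prod_sum_type]
  rfl

theorem isDesign_iff_frameOp_eq_rho [NeZero d] {χ : Frame d ι} :
    IsDesign k χ ↔ frameOp k χ = rho d k := by
  constructor
  · intro h
    ext a b
    rw [← haarMean_tensorProj, ← evalAt_entryPoly, h _ (isBihomogeneous_entryPoly a b),
      evalAt_entryPoly, frameOp_eq_smul_sum, Matrix.smul_apply, Matrix.sum_apply]
    rfl
  · intro h p hp
    obtain ⟨M, hM⟩ := exists_evalAt_eq_trace_mul_tensorProj hp
    rw [hM, haarMean_trace_mul_tensorProj, frameMean_trace_mul_tensorProj, h]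

theorem isDesign_iff_framePotential_eq [Nonempty ι] {χ : Frame d ι} :
    IsDesign k χ ↔ framePotential k χ = 1 / (d.multichoose k : ℝ) := by
  have := χ.neZero
  rw [isDesign_iff_frameOp_eq_rho, frameOp_eq_rho_iff]

/-- The squared norm `⟨φ|φ⟩` as a polynomial in the amplitudes and their conjugates. It is `1` on
pure states, so multiplying by it raises the bidegree without changing any average. -/
def normSqPoly (d : ℕ) : MvPolynomial (Fin d ⊕ Fin d) ℂ :=
  ∑ i, MvPolynomial.X (Sum.inl i) * MvPolynomial.X (Sum.inr i)

theorem evalAt_normSqPoly {φ : H d} (hφ : ‖φ‖ = 1) : evalAt (normSqPoly d) φ = 1 := by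
  have norm_sq : ((∑ i, ‖φ i‖ ^ 2 : ℝ) : ℂ) = 1 := by
    rw [← EuclideanSpace.norm_sq_eq, hφ, one_pow, Complex.ofReal_one]
  simpa [evalAt, normSqPoly, Complex.mul_conj'] using norm_sq

theorem isBihomogeneous_normSqPoly (d : ℕ) : IsBihomogeneous 1 (normSqPoly d) := by
  refine .sum fun i _ => ?_
  simpa [entryPoly] using isBihomogeneous_entryPoly (k := 1) (fun _ => i) fun _ => i

theorem IsDesign.mono {χ : Frame d ι} {l : ℕ} (hkl : k ≤ l) (h : IsDesign l χ) : IsDesign k χ := by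
  intro p hp
  let q := p * normSqPoly d ^ (l - k)
  have hq : IsBihomogeneous l q := by
    have := hp.mul ((isBihomogeneous_normSqPoly d).pow (l - k))
    rwa [mul_one, Nat.add_sub_cancel' hkl] at this
  have evalAt_q {φ : H d} (hφ : ‖φ‖ = 1) : evalAt p φ = evalAt q φ := by
    have eval_normSqPoly := evalAt_normSqPoly hφ
    rw [evalAt] at eval_normSqPoly
    rw [evalAt, evalAt, map_mul, map_pow, eval_normSqPoly, one_pow, mul_one]
  rw [haarMean_congr fun φ hφ => evalAt_q hφ, h q hq, frameMean, frameMean]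
  simp only [evalAt_q (χ.norm_vec _)]

/-! ### Averages of normalized random vectors -/

section IID

variable {n : Type*} [Fintype n]

/-- The orthogonal projector onto the line spanned by `x`, as a matrix; it is `0` for `x = 0`. -/
def lineProj (x : n → ℂ) : Matrix n n ℂ :=
  (((∑ l, ‖x l‖ ^ 2 : ℝ) : ℂ)⁻¹) • Matrix.vecMulVec x (star x)

theorem lineProj_apply (x : n → ℂ) (i j : n) :
    lineProj x i j = ((∑ l, ‖x l‖ ^ 2 : ℝ) : ℂ)⁻¹ * (x i * star (x j)) :=
  rfl

theorem norm_lineProj_apply_le_one (x : n → ℂ) (i j : n) : ‖lineProj x i j‖ ≤ 1 := by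
  have sq_le_sum (l : n) : ‖x l‖ ^ 2 ≤ ∑ l, ‖x l‖ ^ 2 :=
    Finset.single_le_sum (f := fun l => ‖x l‖ ^ 2) (fun _ _ => sq_nonneg _) (Finset.mem_univ l)
  rw [lineProj_apply, norm_mul, norm_inv, norm_mul, norm_star, Complex.norm_real,
    Real.norm_of_nonneg (by positivity)]
  refine inv_mul_le_one_of_le₀ ?_ (by positivity)
  nlinarith [sq_le_sum i, sq_le_sum j, sq_nonneg (‖x i‖ - ‖x j‖)]

theorem integrable_lineProj_apply (μ : Measure (n → ℂ)) [IsFiniteMeasure μ] (i j : n) :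
    Integrable (fun x => lineProj x i j) μ := by
  refine .of_bound (C := 1) (Measurable.aestronglyMeasurable ?_)
    (.of_forall fun x => norm_lineProj_apply_le_one x i j)
  simp only [lineProj_apply]
  fun_prop

theorem trace_lineProj {x : n → ℂ} (hx : x ≠ 0) : (lineProj x).trace = 1 := by
  have sum_ne_zero : ((∑ l, ‖x l‖ ^ 2 : ℝ) : ℂ) ≠ 0 := by
    rw [Complex.ofReal_ne_zero, Ne, Finset.sum_eq_zero_iff_of_nonneg fun _ _ => by positivity]
    simpa [funext_iff] using hx
  rw [lineProj, Matrix.trace_smul, Matrix.trace_vecMulVec, smul_eq_mul, inv_mul_eq_one₀ sum_ne_zero]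
  simp [dotProduct, Complex.mul_conj']

theorem ofReal_inv_mul_norm_sum_sq (x c : n → ℂ) :
    (((∑ i, ‖x i‖ ^ 2)⁻¹ * ‖∑ i, x i * c i‖ ^ 2 : ℝ) : ℂ) =
      ∑ i, ∑ j, c i * star (c j) * lineProj x i j := by
  rw [Complex.ofReal_mul, Complex.ofReal_pow, ← Complex.mul_conj', map_sum, Finset.sum_mul_sum,
    Finset.mul_sum]
  refine Finset.sum_congr rfl fun i _ => ?_
  rw [Finset.mul_sum]
  refine Finset.sum_congr rfl fun j _ => ?_
  rw [lineProj_apply, Complex.ofReal_inv, map_mul, Complex.star_def]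
  ring

variable (ν : Measure ℂ) [IsProbabilityMeasure ν]

theorem integral_lineProj_apply_of_ne [ν.IsNegInvariant] {i j : n} (hij : i ≠ j) :
    ∫ x, lineProj x i j ∂(Measure.pi fun _ => ν) = 0 := by
  classical
  -- Flipping the sign of `x i` preserves the law and the norm, and negates the `(i, j)` entry.
  let flip (x : n → ℂ) : n → ℂ := fun l => if l = i then -x l else x l
  have flip_preserves : MeasurePreserving flip (Measure.pi fun _ => ν) (Measure.pi fun _ => ν) := by
    refine measurePreserving_pi _ _ (f := fun l z => if l = i then -z else z) fun l => ?_
    split_ifs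
    · exact Measure.measurePreserving_neg ν
    · exact .id ν
  have lineProj_flip (x : n → ℂ) : lineProj (flip x) i j = -lineProj x i j := by
    have norm_flip (l : n) : ‖flip x l‖ = ‖x l‖ := by
      simp only [flip]
      split_ifs <;> simp
    simp [lineProj_apply, norm_flip, flip, hij.symm]
  have invariance := integral_map flip_preserves.aemeasurable (f := fun x => lineProj x i j)
    (integrable_lineProj_apply _ i j).aestronglyMeasurable
  rw [flip_preserves.map_eq] at invariance
  simp only [lineProj_flip, integral_neg] at invariance
  exact self_eq_neg.1 invariance

theorem integral_lineProj_apply_self_eq (i j : n) :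
    ∫ x, lineProj x i i ∂(Measure.pi fun _ => ν) =
      ∫ x, lineProj x j j ∂(Measure.pi fun _ => ν) := by
  classical
  have lineProj_swap (x : n → ℂ) :
      lineProj (MeasurableEquiv.arrowCongr' (Equiv.swap i j) (.refl ℂ) x) i i =
        lineProj x j j := by
    have sum_swap := Equiv.sum_comp (Equiv.swap i j) fun l => ‖x l‖ ^ 2
    simp [lineProj_apply, MeasurableEquiv.arrowCongr', Equiv.arrowCongr', ← sum_swap]
  simp only [← lineProj_swap]
  exact ((measurePreserving_arrowCongr' (fun _ => ν) (fun _ => ν) (Equiv.swap i j) (.refl ℂ)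
    fun _ => .id ν).integral_comp' _).symm

theorem integral_lineProj_apply_self [NullSingletonClass ν] (i : n) :
    ∫ x, lineProj x i i ∂(Measure.pi fun _ => ν) = (Fintype.card n : ℂ)⁻¹ := by
  have : Nonempty n := ⟨i⟩
  have trace_eq_one : ∀ᵐ x ∂(Measure.pi fun _ : n => ν), (lineProj x).trace = 1 :=
    (Measure.ae_ne _ 0).mono fun x hx => trace_lineProj hx
  have sum_eq_one : ∑ j : n, ∫ x, lineProj x j j ∂(Measure.pi fun _ => ν) = 1 := by
    rw [← integral_finsetSum _ fun j _ => integrable_lineProj_apply _ j j]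
    exact (integral_congr_ae trace_eq_one).trans (by simp)
  simp only [integral_lineProj_apply_self_eq ν _ i, Finset.sum_const, Finset.card_univ,
    nsmul_eq_mul] at sum_eq_one
  exact eq_inv_of_mul_eq_one_right sum_eq_one

theorem integral_norm_sum_mul_sq_div_sum_norm_sq [ν.IsNegInvariant] [NullSingletonClass ν]
    (c : n → ℂ) :
    ∫ x, (∑ i, ‖x i‖ ^ 2)⁻¹ * ‖∑ i, x i * c i‖ ^ 2 ∂(Measure.pi fun _ => ν) =
      (∑ i, ‖c i‖ ^ 2) / Fintype.card n := by
  rw [← Complex.ofReal_inj, ← integral_complex_ofReal]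
  simp only [ofReal_inv_mul_norm_sum_sq]
  have integrable_term (i j : n) :=
    (integrable_lineProj_apply (Measure.pi fun _ => ν) i j).const_mul (c i * star (c j))
  rw [integral_finsetSum _ fun i _ => integrable_finsetSum _ fun j _ => integrable_term i j,
    Complex.ofReal_div, Complex.ofReal_sum, Finset.sum_div]
  refine Finset.sum_congr rfl fun i _ => ?_
  rw [integral_finsetSum _ fun j _ => integrable_term i j, Finset.sum_eq_single i _ (by simp)]
  · rw [integral_const_mul, integral_lineProj_apply_self, Complex.star_def, Complex.mul_conj']
    push_cast
    rw [div_eq_mul_inv]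
  · intro j _ hji
    rw [integral_const_mul, integral_lineProj_apply_of_ne ν hji.symm, mul_zero]

end IID

instance isProbabilityMeasure_complexGaussian : IsProbabilityMeasure complexGaussian :=
  Measure.isProbabilityMeasure_map Complex.measurableEquivRealProd.symm.measurable.aemeasurable

instance isNegInvariant_complexGaussian : complexGaussian.IsNegInvariant where
  neg_eq_self := by
    have real_preserves : MeasurePreserving Neg.neg (ProbabilityTheory.gaussianReal 0 (1 / 2))
        (ProbabilityTheory.gaussianReal 0 (1 / 2)) :=
      ⟨measurable_neg, by simpa using ProbabilityTheory.gaussianReal_map_neg (μ := 0) (v := 1 / 2)⟩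
    have measurable_mk : Measurable fun z : ℝ × ℝ => (⟨z.1, z.2⟩ : ℂ) :=
      Complex.measurableEquivRealProd.symm.measurable
    have prod_preserves := real_preserves.prod real_preserves
    rw [Measure.neg, complexGaussian, Measure.map_map measurable_neg measurable_mk]
    conv_rhs =>
      rw [← prod_preserves.map_eq, Measure.map_map measurable_mk prod_preserves.measurable]
    rfl

instance nullSingletonClass_complexGaussian : NullSingletonClass complexGaussian where
  measure_singleton z := by
    have := ProbabilityTheory.nullSingletonClass_gaussianReal (μ := 0) (v := 1 / 2) (by simp)
    change Measure.map Complex.measurableEquivRealProd.symm _ _ = 0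
    rw [MeasurableEquiv.map_apply, ← MeasurableEquiv.image_eq_preimage_symm, Set.image_singleton]
    exact measure_singleton _

theorem integral_ginibre_norm_sum_mul_sq_div_sum_norm_sq {n : Type*} [Fintype n] (c : n → n → ℂ) :
    ∫ X, (∑ i, ∑ j, ‖X i j‖ ^ 2)⁻¹ * ‖∑ i, ∑ j, X i j * c i j‖ ^ 2 ∂(ginibre n) =
      (∑ i, ∑ j, ‖c i j‖ ^ 2) / (Fintype.card n : ℝ) ^ 2 := by
  have curry_preserves : MeasurePreserving (MeasurableEquiv.curry n n ℂ)
      (Measure.pi fun _ => complexGaussian) (ginibre n) :=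
    ⟨MeasurableEquiv.measurable _, by
      simpa [Measure.infinitePi_eq_pi, ginibre] using
        Measure.infinitePi_map_curry fun (_ : n) (_ : n) => complexGaussian⟩
  rw [← curry_preserves.integral_comp']
  simp only [← Fintype.sum_prod_type', sq (Fintype.card n : ℝ)]
  simpa using integral_norm_sum_mul_sq_div_sum_norm_sq complexGaussian fun p : n × n => c p.1 p.2

/-! ### The average error -/

/-- The matrix whose columns are the coordinates of the vectors of `symBasis`: the isometry
`ℂ^n → (ℂ^d)^{⊗k}` onto the symmetric subspace. -/
def symBasisMatrix (d k : ℕ) : Matrix (Fin k → Fin d) (Fin (finrank ℂ (symSubspace d k))) ℂ :=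
  Matrix.of fun a i => (symBasis d k i : EuclideanSpace ℂ (Fin k → Fin d)) a

theorem repr_symBasis (v : symSubspace d k) :
    ((symBasis d k).repr v).ofLp = (symBasisMatrix d k)ᴴ *ᵥ v.1.ofLp := by
  ext i
  rw [OrthonormalBasis.repr_apply_apply, Submodule.coe_inner,
    EuclideanSpace.inner_eq_star_dotProduct, dotProduct_comm]
  rfl

theorem symBasisMatrix_mulVec_repr (v : symSubspace d k) :
    symBasisMatrix d k *ᵥ ((symBasis d k).repr v).ofLp = v.1.ofLp := by
  ext a
  have expansion := congrArg (fun v : symSubspace d k => v.1 a) ((symBasis d k).sum_repr v)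
  simpa [Matrix.mulVec, dotProduct, symBasisMatrix, mul_comm] using expansion

theorem symProj_mul_symBasisMatrix (d k : ℕ) :
    symProj d k * symBasisMatrix d k = symBasisMatrix d k := by
  refine symProj_mul_eq_self fun σ => ?_
  ext a i
  rw [permOp_mul_apply]
  exact (symBasis d k i).2 σ a

theorem symBasisMatrix_mul_conjTranspose (d k : ℕ) :
    symBasisMatrix d k * (symBasisMatrix d k)ᴴ = symProj d k := by
  have fixes_symProj : symBasisMatrix d k * ((symBasisMatrix d k)ᴴ * symProj d k) =
      symProj d k := by
    ext a b
    let column : symSubspace d k := ⟨WithLp.toLp 2 fun a => symProj d k a b, fun σ a =>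
      (permOp_mul_apply σ (symProj d k) a b).symm.trans (by rw [permOp_mul_symProj])⟩
    have expansion := symBasisMatrix_mulVec_repr column
    rw [repr_symBasis] at expansion
    exact congrFun expansion a
  have mul_symProj : (symBasisMatrix d k)ᴴ * symProj d k = (symBasisMatrix d k)ᴴ := by
    rw [← (isHermitian_symProj d k).eq, ← Matrix.conjTranspose_mul, symProj_mul_symBasisMatrix]
  rwa [mul_symProj] at fixes_symProj

theorem repr_opOfMatrix (X : Fin (finrank ℂ (symSubspace d k)) →
    Fin (finrank ℂ (symSubspace d k)) → ℂ) (v : symSubspace d k) :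
    ((symBasis d k).repr (opOfMatrix d k X v)).ofLp =
      Matrix.of X *ᵥ ((symBasis d k).repr v).ofLp :=
  Matrix.repr_toLin (symBasis d k).toBasis (symBasis d k).toBasis (Matrix.of X) v

theorem symPoly_opOfMatrix (X : Fin (finrank ℂ (symSubspace d k)) →
    Fin (finrank ℂ (symSubspace d k)) → ℂ) (φ : H d) :
    symPoly (opOfMatrix d k X) φ =
      (symBasisMatrix d k * Matrix.of X * (symBasisMatrix d k)ᴴ * tensorProj k φ).trace := by
  rw [symPoly, ← (symBasis d k).repr.inner_map_map, EuclideanSpace.inner_eq_star_dotProduct,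
    repr_opOfMatrix, repr_symBasis, tensorProj, Matrix.mul_vecMulVec, Matrix.trace_vecMulVec,
    Matrix.star_mulVec, Matrix.conjTranspose_conjTranspose, dotProduct_comm,
    ← Matrix.dotProduct_mulVec, Matrix.mulVec_mulVec, Matrix.mulVec_mulVec, Matrix.mul_assoc,
    dotProduct_comm]
  rfl

theorem hsNorm_opOfMatrix_sq (X : Fin (finrank ℂ (symSubspace d k)) →
    Fin (finrank ℂ (symSubspace d k)) → ℂ) :
    hsNorm (opOfMatrix d k X) ^ 2 = ∑ i, ∑ j, ‖X i j‖ ^ 2 := by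
  rw [hsNorm, Real.sq_sqrt (by positivity), Finset.sum_comm]
  refine Finset.sum_congr rfl fun j _ => ?_
  rw [← (symBasis d k).repr.norm_map, EuclideanSpace.norm_sq_eq, repr_opOfMatrix]
  simp

theorem frobNorm_conjTranspose_mul_mul_symBasisMatrix
    {A : Matrix (Fin k → Fin d) (Fin k → Fin d) ℂ} (hA : A.IsHermitian)
    (symProj_mul : symProj d k * A = A) :
    frobNorm ((symBasisMatrix d k)ᴴ * A * symBasisMatrix d k) = frobNorm A := by
  have trace_eq : ((symBasisMatrix d k)ᴴ * A * symBasisMatrix d k *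
      ((symBasisMatrix d k)ᴴ * A * symBasisMatrix d k)).trace =
        (symProj d k * A * (symProj d k * A)).trace := by
    rw [← symBasisMatrix_mul_conjTranspose]
    simp only [Matrix.mul_assoc]
    rw [Matrix.trace_mul_comm (symBasisMatrix d k)]
    simp only [Matrix.mul_assoc]
  rw [← sq_eq_sq₀ (frobNorm_nonneg _) (frobNorm_nonneg _), ← Complex.ofReal_inj,
    frobNorm_sq_eq_trace, frobNorm_sq_eq_trace, hA.eq,
    (Matrix.isHermitian_conjTranspose_mul_mul (symBasisMatrix d k) hA).eq, trace_eq, symProj_mul]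

theorem avgError_eq [NeZero d] (k : ℕ) (χ : Frame d ι) :
    avgError k χ = frobNorm (frameOp k χ - rho d k) / finrank ℂ (symSubspace d k) := by
  let C := (symBasisMatrix d k)ᴴ * (frameOp k χ - rho d k) * symBasisMatrix d k
  have difference (X : Fin (finrank ℂ (symSubspace d k)) → Fin (finrank ℂ (symSubspace d k)) → ℂ) :
      ‖haarMean (symPoly (opOfMatrix d k X)) - frameMean χ (symPoly (opOfMatrix d k X))‖ =
        ‖∑ i, ∑ j, X i j * C j i‖ := by
    have trace_eq : ∑ i, ∑ j, X i j * C j i = (Matrix.of X * C).trace := rfl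
    rw [funext (symPoly_opOfMatrix X), haarMean_trace_mul_tensorProj,
      frameMean_trace_mul_tensorProj, norm_sub_rev, ← Matrix.trace_sub, ← Matrix.mul_sub, trace_eq,
      Matrix.mul_assoc, Matrix.mul_assoc, Matrix.trace_mul_comm]
    simp only [C, Matrix.mul_assoc]
  have frobNorm_C : frobNorm C = frobNorm (frameOp k χ - rho d k) :=
    frobNorm_conjTranspose_mul_mul_symBasisMatrix
      ((isHermitian_frameOp χ).sub (isHermitian_rho d k))
      (by rw [Matrix.mul_sub, symProj_mul_frameOp, symProj_mul_rho])
  simp only [avgError, hsNorm_opOfMatrix_sq, difference]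
  rw [integral_ginibre_norm_sum_mul_sq_div_sum_norm_sq fun i j => C j i, Finset.sum_comm,
    ← frobNorm_sq, frobNorm_C,
    Fintype.card_fin, ← div_pow, Real.sqrt_sq (div_nonneg (frobNorm_nonneg _) (Nat.cast_nonneg _))]

theorem isOptimalApproxDesign_of_framePotential_le [Nonempty ι] {k' : ℕ} {χ : Frame d ι}
    (hχ : IsDesign k' χ)
    (h : ∀ χ' : Frame d (Fin (Fintype.card ι)), IsDesign k' χ' →
      framePotential k χ ≤ framePotential k χ') :
    IsOptimalApproxDesign k' k χ := by
  have := χ.neZero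
  refine ⟨hχ, fun χ' hχ' => ?_⟩
  have frobNorm_le : frobNorm (frameOp k χ - rho d k) ≤ frobNorm (frameOp k χ' - rho d k) := by
    rw [← sq_le_sq₀ (frobNorm_nonneg _) (frobNorm_nonneg _), frobNorm_frameOp_sub_rho_sq,
      frobNorm_frameOp_sub_rho_sq]
    exact sub_le_sub_right (h χ' hχ') _
  refine ⟨h χ' hχ', frobNorm_le, ?_⟩
  rw [avgError_eq, avgError_eq]
  gcongr

/-! ### Bounds on the third frame potential -/

theorem le_framePotential_add_two (k : ℕ) (χ : Frame d ι) (t : ℝ) :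
    2 * t * framePotential (k + 1) χ - t ^ 2 * framePotential k χ +
      (1 - t) ^ 2 / Fintype.card ι ≤ framePotential (k + 2) χ := by
  have diagonal_le (i : ι) : (1 - t) ^ 2 ≤ ∑ j, (‖inner ℂ (χ.vec i) (χ.vec j)‖ ^ 2) ^ k *
      (‖inner ℂ (χ.vec i) (χ.vec j)‖ ^ 2 - t) ^ 2 := by
    refine le_of_eq_of_le ?_ (Finset.single_le_sum (fun _ _ => by positivity) (Finset.mem_univ i))
    simp [inner_self_eq_norm_sq_to_K, χ.norm_vec i]
  have defect : framePotential (k + 2) χ - 2 * t * framePotential (k + 1) χ +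
      t ^ 2 * framePotential k χ = 1 / (Fintype.card ι : ℝ) ^ 2 * ∑ i, ∑ j,
        (‖inner ℂ (χ.vec i) (χ.vec j)‖ ^ 2) ^ k * (‖inner ℂ (χ.vec i) (χ.vec j)‖ ^ 2 - t) ^ 2 := by
    simp only [framePotential, Finset.mul_sum, ← Finset.sum_sub_distrib, ← Finset.sum_add_distrib]
    refine Finset.sum_congr rfl fun i _ => Finset.sum_congr rfl fun j _ => ?_
    ring
  calc 2 * t * framePotential (k + 1) χ - t ^ 2 * framePotential k χ +
        (1 - t) ^ 2 / Fintype.card ι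
      = 2 * t * framePotential (k + 1) χ - t ^ 2 * framePotential k χ +
          1 / (Fintype.card ι : ℝ) ^ 2 * ∑ _i : ι, (1 - t) ^ 2 := by
        rw [Finset.sum_const, Finset.card_univ, nsmul_eq_mul]
        field_simp
    _ ≤ 2 * t * framePotential (k + 1) χ - t ^ 2 * framePotential k χ +
          1 / (Fintype.card ι : ℝ) ^ 2 * ∑ i, ∑ j, (‖inner ℂ (χ.vec i) (χ.vec j)‖ ^ 2) ^ k *
            (‖inner ℂ (χ.vec i) (χ.vec j)‖ ^ 2 - t) ^ 2 := by
        gcongr with i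
        exact diagonal_le i
    _ = framePotential (k + 2) χ := by
        rw [← defect]
        ring

theorem cast_multichoose_two_right (d : ℕ) : (d.multichoose 2 : ℝ) = d * (d + 1) / 2 := by
  rw [Nat.multichoose_eq, Nat.add_sub_assoc one_le_two, Nat.cast_choose_two]
  push_cast
  ring

theorem IsDesign.le_framePotential_three [Nonempty ι] {χ : Frame d ι} (h : IsDesign 1 χ) {t : ℝ}
    (ht : 0 ≤ t) :
    4 * t / (d * (d + 1)) - t ^ 2 / d + (1 - t) ^ 2 / Fintype.card ι ≤ framePotential 3 χ := by
  have potential_one : framePotential 1 χ = 1 / d := by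
    rw [isDesign_iff_framePotential_eq.1 h, Nat.multichoose_one_right]
  have potential_two_ge : 1 / (d * (d + 1) / 2 : ℝ) ≤ framePotential 2 χ := by
    rw [← cast_multichoose_two_right]
    exact one_div_multichoose_le_framePotential χ
  calc 4 * t / (d * (d + 1)) - t ^ 2 / d + (1 - t) ^ 2 / Fintype.card ι
      = 2 * t * (1 / (d * (d + 1) / 2 : ℝ)) - t ^ 2 * framePotential 1 χ +
          (1 - t) ^ 2 / Fintype.card ι := by
        rw [potential_one, one_div_div]
        ring
    _ ≤ 2 * t * framePotential 2 χ - t ^ 2 * framePotential 1 χ +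
          (1 - t) ^ 2 / Fintype.card ι := by gcongr
    _ ≤ framePotential 3 χ := le_framePotential_add_two 1 χ t

theorem IsDesign.le_framePotential_three_of_card_eq_mul [Nonempty ι] {χ : Frame d ι}
    (h : IsDesign 1 χ) (hcard : Fintype.card ι = d * (d + 1)) :
    1 / (d : ℝ) ^ 2 ≤ framePotential 3 χ := by
  have d_ne_zero := χ.neZero.ne
  refine le_of_eq_of_le ?_ (h.le_framePotential_three (t := 1 / d) (by positivity))
  rw [hcard]
  push_cast
  field_simp
  ring

theorem IsDesign.le_framePotential_three_of_card_eq_sq [Nonempty ι] {χ : Frame d ι}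
    (h : IsDesign 1 χ) (hcard : Fintype.card ι = d ^ 2) :
    ((d : ℝ) + 3) / (d * (d + 1) ^ 2) ≤ framePotential 3 χ := by
  have d_ne_zero := χ.neZero.ne
  refine le_of_eq_of_le ?_ (h.le_framePotential_three (t := 1 / (d + 1)) (by positivity))
  rw [hcard]
  push_cast
  field_simp
  ring

theorem framePotential_eq_div_card {χ : Frame d ι} {c : ℝ}
    (h : ∀ i, ∑ j, ‖inner ℂ (χ.vec i) (χ.vec j)‖ ^ (2 * k) = c) :
    framePotential k χ = c / Fintype.card ι := by
  simp only [framePotential, h, Finset.sum_const, Finset.card_univ, nsmul_eq_mul]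
  field_simp

theorem CompleteMUB.framePotential_frame (B : CompleteMUB d) (hk : k ≠ 0) :
    framePotential k B.frame = (1 + d ^ 2 * (1 / d) ^ k) / (d * (d + 1)) := by
  have same_basis (α : Fin (d + 1)) (i : Fin d) :
      ∑ j, ‖inner ℂ (B.basis α i) (B.basis α j)‖ ^ (2 * k) = 1 := by
    simp [OrthonormalBasis.inner_eq_ite, apply_ite norm, ite_pow, hk]
  have other_basis {α β : Fin (d + 1)} (hβ : β ≠ α) (i : Fin d) :
      ∑ j, ‖inner ℂ (B.basis α i) (B.basis β j)‖ ^ (2 * k) = d * (1 / d : ℝ) ^ k := by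
    simp [pow_mul, B.unbiased α β hβ.symm]
  rw [framePotential_eq_div_card (c := 1 + d ^ 2 * (1 / d) ^ k)]
  · simp [mul_comm]
  · rintro ⟨α, i⟩
    rw [Fintype.sum_prod_type, Fintype.sum_eq_add_sum_compl α]
    simp only [CompleteMUB.frame, same_basis]
    rw [Finset.sum_congr rfl fun β hβ => other_basis (by simpa using hβ) i]
    simp only [Finset.sum_const, Finset.card_compl, Fintype.card_fin, Finset.card_singleton,
      Nat.add_sub_cancel, nsmul_eq_mul]
    ring

theorem IsSIC.framePotential_eq {χ : Frame d (Fin (d ^ 2))} (h : IsSIC χ) (k : ℕ) :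
    framePotential k χ = (1 + (d ^ 2 - 1) * (1 / (d + 1)) ^ k) / d ^ 2 := by
  rw [framePotential_eq_div_card (c := 1 + (d ^ 2 - 1) * (1 / (d + 1)) ^ k)]
  · simp
  · intro i
    have off_diagonal {j : Fin (d ^ 2)} (hj : j ≠ i) :
        ‖inner ℂ (χ.vec i) (χ.vec j)‖ ^ (2 * k) = (1 / (d + 1) : ℝ) ^ k := by
      rw [pow_mul, h i j hj.symm]
    rw [Fintype.sum_eq_add_sum_compl i,
      Finset.sum_congr rfl fun j hj => off_diagonal (by simpa using hj)]
    have := i.pos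
    simp [inner_self_eq_norm_sq_to_K, χ.norm_vec i, Finset.card_compl, Nat.cast_sub this]

theorem CompleteMUB.isDesign_two [NeZero d] (B : CompleteMUB d) : IsDesign 2 B.frame := by
  have d_ne_zero := NeZero.ne d
  rw [isDesign_iff_framePotential_eq, B.framePotential_frame two_ne_zero,
    cast_multichoose_two_right]
  field_simp
  norm_num

theorem IsSIC.isDesign_two [NeZero d] {χ : Frame d (Fin (d ^ 2))} (h : IsSIC χ) :
    IsDesign 2 χ := by
  have d_ne_zero := NeZero.ne d
  rw [isDesign_iff_framePotential_eq, h.framePotential_eq, cast_multichoose_two_right]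
  field_simp
  ring

theorem CompleteMUB.framePotential_three [NeZero d] (B : CompleteMUB d) :
    framePotential 3 B.frame = 1 / (d : ℝ) ^ 2 := by
  have d_ne_zero := NeZero.ne d
  rw [B.framePotential_frame three_ne_zero]
  field_simp

theorem CompleteMUB.isOptimalApproxDesign [NeZero d] (B : CompleteMUB d) :
    IsOptimalApproxDesign 1 3 B.frame := by
  refine isOptimalApproxDesign_of_framePotential_le (B.isDesign_two.mono one_le_two)
    fun χ' hχ' => ?_
  have : Nonempty (Fin (Fintype.card (Fin (d + 1) × Fin d))) :=
    Fin.pos_iff_nonempty.1 Fintype.card_pos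
  rw [B.framePotential_three]
  exact hχ'.le_framePotential_three_of_card_eq_mul (by simp [mul_comm])

theorem IsSIC.framePotential_three [NeZero d] {χ : Frame d (Fin (d ^ 2))} (h : IsSIC χ) :
    framePotential 3 χ = ((d : ℝ) + 3) / (d * (d + 1) ^ 2) := by
  have d_ne_zero := NeZero.ne d
  rw [h.framePotential_eq]
  field_simp
  ring

theorem IsSIC.isOptimalApproxDesign [NeZero d] {χ : Frame d (Fin (d ^ 2))} (h : IsSIC χ) :
    IsOptimalApproxDesign 1 3 χ := by
  refine isOptimalApproxDesign_of_framePotential_le (h.isDesign_two.mono one_le_two)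
    fun χ' hχ' => ?_
  have : Nonempty (Fin (Fintype.card (Fin (d ^ 2)))) := Fin.pos_iff_nonempty.1 Fintype.card_pos
  rw [h.framePotential_three]
  exact hχ'.le_framePotential_three_of_card_eq_sq (by simp)

end ProjectiveDesign

end

theorem mainTheorem4_general (d : ℕ) (hd : 0 < d) :
    (∀ χ : Frame d (Fin (d * (d + 1))), IsDesign 1 χ →
      1 / (d : ℝ) ^ 2 ≤ framePotential 3 χ) ∧
    (∀ B : CompleteMUB d,
      framePotential 3 B.frame = 1 / (d : ℝ) ^ 2 ∧
      IsDesign 2 B.frame ∧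
      IsOptimalApproxDesign 1 3 B.frame) ∧
    (∀ χ : Frame d (Fin (d ^ 2)), IsDesign 1 χ →
      ((d : ℝ) + 3) / ((d : ℝ) * ((d : ℝ) + 1) ^ 2) ≤ framePotential 3 χ) ∧
    (∀ χ : Frame d (Fin (d ^ 2)), IsSIC χ →
      framePotential 3 χ = ((d : ℝ) + 3) / ((d : ℝ) * ((d : ℝ) + 1) ^ 2) ∧
      IsDesign 2 χ ∧
      IsOptimalApproxDesign 1 3 χ) := by
  have : NeZero d := ⟨hd.ne'⟩
  exact ⟨fun χ hχ => hχ.le_framePotential_three_of_card_eq_mul (Fintype.card_fin _),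
    fun B => ⟨B.framePotential_three, B.isDesign_two, B.isOptimalApproxDesign⟩,
    fun χ hχ => hχ.le_framePotential_three_of_card_eq_sq (Fintype.card_fin _),
    fun χ hχ => ⟨hχ.framePotential_three, hχ.isDesign_two, hχ.isOptimalApproxDesign⟩⟩

theorem mainTheorem4 (d : ℕ) (hd : 2 ≤ d) :
    (∀ χ : Frame d (Fin (d * (d + 1))), IsDesign 1 χ →
      1 / (d : ℝ) ^ 2 ≤ framePotential 3 χ) ∧
    (∀ B : CompleteMUB d,
      framePotential 3 B.frame = 1 / (d : ℝ) ^ 2 ∧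
      IsDesign 2 B.frame ∧
      IsOptimalApproxDesign 1 3 B.frame) ∧
    (∀ χ : Frame d (Fin (d ^ 2)), IsDesign 2 χ →
      ((d : ℝ) + 3) / ((d : ℝ) * ((d : ℝ) + 1) ^ 2) ≤ framePotential 3 χ) ∧
    (∀ χ : Frame d (Fin (d ^ 2)), IsSIC χ →
      framePotential 3 χ = ((d : ℝ) + 3) / ((d : ℝ) * ((d : ℝ) + 1) ^ 2) ∧
      IsOptimalApproxDesign 2 3 χ) := by
  obtain ⟨mub_bound, mub_optimal, sic_bound, sic_optimal⟩ :=
    mainTheorem4_general d (two_pos.trans_le hd)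
  refine ⟨mub_bound, mub_optimal, fun χ hχ => sic_bound χ (hχ.mono one_le_two), fun χ hχ => ?_⟩
  obtain ⟨potential_eq, is_two_design, -, is_optimal⟩ := sic_optimal χ hχ
  exact ⟨potential_eq, is_two_design, fun χ' hχ' => is_optimal χ' (hχ'.mono one_le_two)⟩
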